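/- Let $n\ge 0$ be an integer, $r\in(0,+\infty]$, and let $H$ be an infinite-dimensional complex Hilbert space. Let $W_n=\bigsqcup_{d\ge 0}\{1,\dots,n\}^d$ be the set of words in $n$ letters, $|\alpha|$ the length of $\alpha\in W_n$, and let $\mathfrak F_n$ be the algebra of formal series $a=\sum_{\alpha\in W_n}c_\alpha\zeta_\alpha$ ($c_\alpha\in\mathbb C$) in noncommuting variables $\zeta_1,\dots,\zeta_n$, with $\zeta_\alpha\zeta_\beta=\zeta_{\alpha\beta}$. For $\alpha\in W_n$ let $p(\alpha)\in\mathbb Z_+^n$ be the vector whose $j$-th entry is the number of occurrences of the letter $j$ in $\alpha$, and for $k\in\mathbb Z_+^n$ put $|k|=k_1+\dots+k_n$. Let $\mathcal F(\mathbb B^n_r)$ be Popescu's algebra of all $a\in\mathfrak F_n$ whose radius of convergence $R(a)\in[0,+\infty]$, defined by $1/R(a)=\limsup_{d\to\infty}\bigl(\sum_{|\alpha|=d}|c_\alpha|^2\bigr)^{1/(2d)}$, satisfies $R(a)\ge r$. Give it the topology determined by the norms $$\|a\|^P_\rho=\sup\{\|a(T)\| : T=(T_1,\dots,T_n)\in\mathcal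 B(H)^n,\ \|T\|\le\rho\}\qquad(0<\rho<r),$$ where $a(T)=\sum_{d\ge 0}\sum_{|\alpha|=d}c_\alpha T_\alpha$, with $T_\alpha=T_{\alpha_1}\cdots T_{\alpha_d}$, and $\|T\|$ is the norm of the row operator $H^n\to H$, $(x_i)\mapsto\sum_i T_ix_i$. Let $\mathcal A$ be the algebra of all $a=\sum_\alpha c_\alpha\zeta_\alpha\in\mathfrak F_n$ such that $$\|a\|_\rho=\sum_{k\in\mathbb Z_+^n}\Bigl(\sum_{\alpha\in p^{-1}(k)}|c_\alpha|^2\Bigr)^{1/2}\rho^{|k|}<\infty\qquad\text{for all }\rho\in(0,r),$$ with the topology determined by the $\|\cdot\|_\rho$ ($0<\rho<r$). Then there is an isomorphism of algebras $\mathcal F(\mathbb B^n_r)\cong\mathcal A$ that is a homeomorphism, namely the one that sends each series to itself (so the two algebras consist of the same series and carry the same topology). Moreover, for every $\rho\in(0,r)$, $\|\cdot\|_\rho$ is a norm on $\mathcal A$ and is submultiplicative: $\|ab\|_\rho\le\|a\|_\rho\,\|b\|_\rho$ for all $a,b\in\mathcal A$. -/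

import Mathlib

open scoped NNReal ENNReal Topology
noncomputable section
/-- Free formal series `∑_α c_α ζ_α` in `n` noncommuting indeterminates with complex coefficients,
indexed by the words `α` in the letters `0, …, n - 1`. -/
@[ext] structure FreeSeries (n : ℕ) : Type where
  /-- The coefficient `c_α`. -/
  coeff : List (Fin n) → ℂ

namespace FreeSeries
variable {n : ℕ}

instance : CoeFun (FreeSeries n) fun _ => List (Fin n) → ℂ := ⟨coeff⟩

/-- A free series is the same as its family of coefficients. -/
def coeffEquiv (n : ℕ) : FreeSeries n ≃ (List (Fin n) → ℂ) where
  toFun := coeff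
  invFun := mk
  left_inv _ := rfl
  right_inv _ := rfl

instance : AddCommGroup (FreeSeries n) := (coeffEquiv n).addCommGroup
instance : Module ℂ (FreeSeries n) := (coeffEquiv n).module ℂ

/-- Multiplication is the concatenation product: the coefficient of `a * b` at `α` is the sum of
`a β * b γ` over all factorizations `α = βγ`. -/
instance : Mul (FreeSeries n) :=
  ⟨fun a b => ⟨fun α => ∑ i ∈ Finset.range (α.length + 1), a (α.take i) * b (α.drop i)⟩⟩
instance : One (FreeSeries n) := ⟨⟨fun α => if α = [] then 1 else 0⟩⟩

theorem ext' {a b : FreeSeries n} (h : ∀ α : List (Fin n), a α = b α) : a = b :=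
  FreeSeries.ext (funext h)
theorem add_apply (a b : FreeSeries n) (α : List (Fin n)) : (a + b) α = a α + b α := rfl
theorem zero_apply (α : List (Fin n)) : (0 : FreeSeries n) α = 0 := rfl
theorem smul_apply (z : ℂ) (a : FreeSeries n) (α : List (Fin n)) : (z • a) α = z * a α := rfl
theorem one_apply (α : List (Fin n)) : (1 : FreeSeries n) α = if α = [] then 1 else 0 := rfl
theorem mul_apply (a b : FreeSeries n) (α : List (Fin n)) :
    (a * b) α = ∑ i ∈ Finset.range (α.length + 1), a (α.take i) * b (α.drop i) := rfl

theorem assoc' (a b c : FreeSeries n) : a * b * c = a * (b * c) := by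
  refine ext' fun α => ?_
  simp only [mul_apply, Finset.sum_mul, Finset.mul_sum, Finset.sum_sigma']
  refine Finset.sum_nbij' (fun x => ⟨x.2, x.1 - x.2⟩) (fun x => ⟨x.1 + x.2, x.1⟩) ?_ ?_ ?_ ?_ ?_
  · rintro ⟨i, j⟩ h
    simp at h ⊢; omega
  · rintro ⟨i, j⟩ h
    simp at h ⊢; omega
  · rintro ⟨i, j⟩ h
    simp at h ⊢; omega
  · rintro ⟨i, j⟩ h
    simp
  · rintro ⟨i, j⟩ h
    simp only [Finset.mem_sigma, Finset.mem_range, List.length_take] at h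
    have h1 : j ≤ i := by omega
    simp only [List.take_take, List.drop_drop, List.drop_take, mul_assoc]
    rw [min_eq_left h1, Nat.add_sub_cancel' h1]

theorem one_mul' (a : FreeSeries n) : 1 * a = a := by
  refine ext' fun α => ?_
  rw [mul_apply, Finset.sum_eq_single 0]
  · simp [one_apply]
  · intro i hi h0
    rw [one_apply, if_neg, zero_mul]
    simp at hi ⊢
    refine ⟨h0, fun h => ?_⟩
    subst h; simp at hi; omega
  · simp

theorem mul_one' (a : FreeSeries n) : a * 1 = a := by
  refine ext' fun α => ?_
  rw [mul_apply, Finset.sum_eq_single α.length]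
  · simp [one_apply]
  · intro i hi h0
    rw [one_apply, if_neg, mul_zero]
    simp at hi ⊢
    omega
  · simp

instance : Ring (FreeSeries n) :=
  { (inferInstance : AddCommGroup (FreeSeries n)) with
    mul := (· * ·)
    one := 1
    left_distrib := fun a b c => by
      refine ext' fun α => ?_; simp only [mul_apply, add_apply, mul_add, Finset.sum_add_distrib]
    right_distrib := fun a b c => by
      refine ext' fun α => ?_; simp only [mul_apply, add_apply, add_mul, Finset.sum_add_distrib]
    zero_mul := fun a => by refine ext' fun α => ?_; simp [mul_apply, zero_apply]
    mul_zero := fun a => by refine ext' fun α => ?_; simp [mul_apply, zero_apply]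
    mul_assoc := assoc'
    one_mul := one_mul'
    mul_one := mul_one' }

instance : Algebra ℂ (FreeSeries n) :=
  Algebra.ofModule
    (fun z a b => by refine ext' fun α => ?_; simp only [mul_apply, smul_apply, Finset.mul_sum, mul_assoc])
    (fun z a b => by
      refine ext' fun α => ?_; simp only [mul_apply, smul_apply, Finset.mul_sum]
      exact Finset.sum_congr rfl fun i _ => by ring)


/-- The `ℓ²`-norm of the part of `a` supported on the words `α` with `φ α = m`. -/
def gradeNorm {M : Type} (φ : List (Fin n) → M) (m : M) (a : FreeSeries n) : ℝ≥0∞ :=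
  (∑' α : {α : List (Fin n) // φ α = m}, ‖a α.1‖ₑ ^ 2) ^ (1 / 2 : ℝ)

theorem tsum_cauchySchwarz {ι : Type} (f g : ι → ℝ≥0∞) :
    ∑' i, f i * g i ≤ (∑' i, f i ^ 2) ^ (1 / 2 : ℝ) * (∑' i, g i ^ 2) ^ (1 / 2 : ℝ) := by
  rw [ENNReal.tsum_eq_iSup_sum]
  refine iSup_le fun s => ?_
  have h := ENNReal.inner_le_Lp_mul_Lq s f g (p := 2) (q := 2) Real.HolderConjugate.two_two
  simp only [ENNReal.rpow_two] at h
  refine h.trans ?_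
  gcongr <;> exact ENNReal.sum_le_tsum s

theorem tsum_minkowski {ι : Type} (f g : ι → ℝ≥0∞) :
    (∑' i, (f i + g i) ^ 2) ^ (1 / 2 : ℝ) ≤
      (∑' i, f i ^ 2) ^ (1 / 2 : ℝ) + (∑' i, g i ^ 2) ^ (1 / 2 : ℝ) := by
  rw [one_div, ENNReal.rpow_inv_le_iff (by norm_num), ENNReal.tsum_eq_iSup_sum]
  refine iSup_le fun s => ?_
  rw [← ENNReal.rpow_inv_le_iff (by norm_num)]
  have h := ENNReal.Lp_add_le s f g (p := 2) (by norm_num)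
  simp only [ENNReal.rpow_two, one_div] at h
  refine h.trans ?_
  gcongr <;> exact ENNReal.sum_le_tsum s

section grade
variable {M : Type} (φ : List (Fin n) → M)

theorem gradeNorm_add (m : M) (a b : FreeSeries n) :
    gradeNorm φ m (a + b) ≤ gradeNorm φ m a + gradeNorm φ m b := by
  refine le_trans ?_ (tsum_minkowski _ _)
  unfold gradeNorm
  gcongr with α
  rw [add_apply]
  exact enorm_add_le _ _

theorem gradeNorm_smul (m : M) (z : ℂ) (a : FreeSeries n) :
    gradeNorm φ m (z • a) = ‖z‖ₑ * gradeNorm φ m a := by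
  unfold gradeNorm
  simp only [smul_apply, enorm_mul, mul_pow, ENNReal.tsum_mul_left]
  rw [ENNReal.mul_rpow_of_nonneg _ _ (by norm_num), ← ENNReal.rpow_two, ← ENNReal.rpow_mul]
  norm_num

variable (deg : M → ℕ)

theorem gradeSq_ne_top (hdeg : ∀ α, deg (φ α) = α.length) (m : M) (a : FreeSeries n) :
    ∑' α : {α : List (Fin n) // φ α = m}, ‖a α.1‖ₑ ^ 2 ≠ ∞ := by
  have : Finite {α : List (Fin n) // φ α = m} := by
    refine Set.Finite.subset (List.finite_length_eq (Fin n) (deg m)) ?_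
    rintro α rfl
    exact (hdeg α).symm
  have := Fintype.ofFinite {α : List (Fin n) // φ α = m}
  rw [tsum_fintype]
  exact ENNReal.sum_ne_top.2 fun α _ => ENNReal.pow_ne_top enorm_ne_top

/-- The weighted `ℓ¹`-sum of the norms of the graded parts. -/
def gradeSum (ρ : ℝ≥0) (a : FreeSeries n) : ℝ≥0∞ :=
  ∑' m : M, gradeNorm φ m a * (ρ : ℝ≥0∞) ^ deg m

theorem gradeSum_add (ρ : ℝ≥0) (a b : FreeSeries n) :
    gradeSum φ deg ρ (a + b) ≤ gradeSum φ deg ρ a + gradeSum φ deg ρ b := by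
  unfold gradeSum
  rw [← ENNReal.tsum_add]
  refine ENNReal.tsum_le_tsum fun m => ?_
  rw [← add_mul]
  gcongr
  exact gradeNorm_add φ m a b

theorem gradeSum_smul (ρ : ℝ≥0) (z : ℂ) (a : FreeSeries n) :
    gradeSum φ deg ρ (z • a) = ‖z‖ₑ * gradeSum φ deg ρ a := by
  unfold gradeSum
  simp only [gradeNorm_smul, mul_assoc, ENNReal.tsum_mul_left]

theorem gradeSum_one (hdeg : ∀ α, deg (φ α) = α.length) (ρ : ℝ≥0) :
    gradeSum φ deg ρ (1 : FreeSeries n) ≠ ∞ := by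
  unfold gradeSum
  rw [tsum_eq_single (φ [])]
  · refine ENNReal.mul_ne_top ?_ (ENNReal.pow_ne_top ENNReal.coe_ne_top)
    exact ENNReal.rpow_ne_top_of_nonneg (by norm_num) (gradeSq_ne_top φ deg hdeg _ _)
  · intro m hm
    have : ∀ α : {α : List (Fin n) // φ α = m}, ‖(1 : FreeSeries n) α.1‖ₑ ^ 2 = 0 := by
      rintro ⟨α, rfl⟩
      rw [one_apply, if_neg (by rintro rfl; exact hm rfl)]
      simp
    simp [gradeNorm, this]

variable [AddCommMonoid M]

theorem gradeNorm_mul (hdeg : ∀ α, deg (φ α) = α.length)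
    (hφ : ∀ α β, φ (α ++ β) = φ α + φ β) (m : M) (a b : FreeSeries n) [DecidableEq M] :
    gradeNorm φ m (a * b) ≤
      ∑' x : M × M, if x.1 + x.2 = m then gradeNorm φ x.1 a * gradeNorm φ x.2 b else 0 := by
  set K := ∑' x : M × M, if x.1 + x.2 = m then gradeNorm φ x.1 a * gradeNorm φ x.2 b else 0
    with hK
  set S := ∑' α : {α : List (Fin n) // φ α = m}, ‖(a * b) α.1‖ₑ ^ 2 with hS
  have hS' : gradeNorm φ m (a * b) = S ^ (1 / 2 : ℝ) := rfl
  have hSt : S ≠ ∞ := gradeSq_ne_top φ deg hdeg m _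
  suffices h : S ≤ S ^ (1 / 2 : ℝ) * K by
    rw [hS']
    by_cases h0 : S = 0
    · simp [h0]
    have h1 : S ^ (1 / 2 : ℝ) ≠ 0 := by simp [h0]
    have h2 : S ^ (1 / 2 : ℝ) ≠ ∞ := by simp [hSt]
    rw [← ENNReal.mul_le_mul_iff_right h1 h2]
    refine le_trans (le_of_eq ?_) h
    rw [← ENNReal.rpow_add _ _ h0 hSt]
    norm_num
  let g : List (Fin n) × List (Fin n) → ℝ≥0∞ := fun x =>
    if φ x.1 + φ x.2 = m then ‖(a * b) (x.1 ++ x.2)‖ₑ * (‖a x.1‖ₑ * ‖b x.2‖ₑ) else 0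
  have step1 : S ≤ ∑' x, g x := by
    let e : (Σ α : {α : List (Fin n) // φ α = m}, Fin (α.1.length + 1)) →
        List (Fin n) × List (Fin n) := fun y => (y.1.1.take y.2, y.1.1.drop y.2)
    have he : Function.Injective e := by
      rintro ⟨⟨α, hα⟩, i⟩ ⟨⟨β, hβ⟩, j⟩ h
      simp only [e, Prod.mk.injEq] at h
      have h1 : α = β := by
        rw [← List.take_append_drop i α, ← List.take_append_drop j β, h.1, h.2]
      subst h1
      have h2 := congrArg List.length h.1
      simp only [List.length_take] at h2
      have h3 : i.1 < α.length + 1 := i.2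
      have h4 : j.1 < α.length + 1 := j.2
      rw [min_eq_left (Nat.lt_succ_iff.1 h3), min_eq_left (Nat.lt_succ_iff.1 h4)] at h2
      have : i = j := Fin.ext h2
      subst this; rfl
    refine le_trans ?_ (ENNReal.tsum_comp_le_tsum_of_injective he g)
    rw [ENNReal.tsum_sigma']
    refine ENNReal.tsum_le_tsum fun α => ?_
    rw [pow_two, tsum_fintype]
    have : ∀ i : Fin (α.1.length + 1), g (e ⟨α, i⟩) =
        ‖(a * b) α.1‖ₑ * (‖a (α.1.take i)‖ₑ * ‖b (α.1.drop i)‖ₑ) := fun i => by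
      simp only [g, e]
      rw [List.take_append_drop, ← hφ, List.take_append_drop, if_pos α.2]
    simp only [this]
    rw [← Finset.mul_sum]
    gcongr
    rw [mul_apply, Finset.sum_range]
    refine (enorm_sum_le _ _).trans ?_
    simp only [enorm_mul, le_refl]
  refine step1.trans ?_
  rw [← (Equiv.sigmaFiberEquiv (fun x : List (Fin n) × List (Fin n) =>
    (φ x.1, φ x.2))).tsum_eq g, ENNReal.tsum_sigma', hK, ← ENNReal.tsum_mul_left]
  refine ENNReal.tsum_le_tsum fun ij => ?_
  obtain ⟨i, j⟩ := ij
  by_cases hij : i + j = m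
  swap
  · refine le_of_eq_of_le ?_ zero_le
    rw [ENNReal.tsum_eq_zero]
    rintro ⟨⟨β, γ⟩, h⟩
    simp only [Prod.mk.injEq] at h
    simp [g, h.1, h.2, hij]
  have hg : ∀ x : {x : List (Fin n) × List (Fin n) // (φ x.1, φ x.2) = (i, j)},
      g (Equiv.sigmaFiberEquiv (fun x : List (Fin n) × List (Fin n) => (φ x.1, φ x.2)) ⟨(i, j), x⟩)
        = ‖(a * b) (x.1.1 ++ x.1.2)‖ₑ * (‖a x.1.1‖ₑ * ‖b x.1.2‖ₑ) := by
    rintro ⟨⟨β, γ⟩, h⟩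
    simp only [Prod.mk.injEq] at h
    simp [g, h.1, h.2, hij]
  simp only [hg, if_pos hij]
  refine (tsum_cauchySchwarz _ _).trans ?_
  gcongr
  · let e : {x : List (Fin n) × List (Fin n) // (φ x.1, φ x.2) = (i, j)} →
        {α : List (Fin n) // φ α = m} := fun x => ⟨x.1.1 ++ x.1.2, by
          have := x.2
          simp only [Prod.mk.injEq] at this
          rw [hφ, this.1, this.2, hij]⟩
    have he : Function.Injective e := by
      rintro ⟨⟨β, γ⟩, h⟩ ⟨⟨β', γ'⟩, h'⟩ hh
      simp only [Prod.mk.injEq] at h h'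
      simp only [e, Subtype.mk.injEq] at hh
      have hl : β.length = β'.length := by rw [← hdeg, ← hdeg, h.1, h'.1]
      obtain ⟨h1, h2⟩ := List.append_inj hh hl
      subst h1; subst h2; rfl
    exact ENNReal.tsum_comp_le_tsum_of_injective he
      (fun α : {α : List (Fin n) // φ α = m} => ‖(a * b) α.1‖ₑ ^ 2)
  · unfold gradeNorm
    rw [← ENNReal.mul_rpow_of_nonneg _ _ (by norm_num)]
    gcongr
    rw [← ENNReal.tsum_mul_right]
    simp only [← ENNReal.tsum_mul_left]
    rw [← ENNReal.tsum_prod]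
    let e : {x : List (Fin n) × List (Fin n) // (φ x.1, φ x.2) = (i, j)} →
        {α : List (Fin n) // φ α = i} × {α : List (Fin n) // φ α = j} := fun x =>
          (⟨x.1.1, (Prod.mk.inj x.2).1⟩, ⟨x.1.2, (Prod.mk.inj x.2).2⟩)
    have he : Function.Injective e := by
      rintro ⟨⟨β, γ⟩, h⟩ ⟨⟨β', γ'⟩, h'⟩ hh
      simp only [e, Prod.mk.injEq, Subtype.mk.injEq] at hh
      obtain ⟨h1, h2⟩ := hh
      subst h1; subst h2; rfl
    simp only [mul_pow]
    exact ENNReal.tsum_comp_le_tsum_of_injective he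
      (fun x : {α : List (Fin n) // φ α = i} × {α : List (Fin n) // φ α = j} =>
        ‖a x.1.1‖ₑ ^ 2 * ‖b x.2.1‖ₑ ^ 2)

theorem gradeSum_mul (hdeg : ∀ α, deg (φ α) = α.length)
    (hφ : ∀ α β, φ (α ++ β) = φ α + φ β) (hadd : ∀ i j, deg (i + j) = deg i + deg j)
    (ρ : ℝ≥0) (a b : FreeSeries n) :
    gradeSum φ deg ρ (a * b) ≤ gradeSum φ deg ρ a * gradeSum φ deg ρ b := by
  classical
  unfold gradeSum
  calc ∑' m, gradeNorm φ m (a * b) * (ρ : ℝ≥0∞) ^ deg m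
      ≤ ∑' m, (∑' x : M × M, if x.1 + x.2 = m then gradeNorm φ x.1 a * gradeNorm φ x.2 b else 0) *
          (ρ : ℝ≥0∞) ^ deg m := by
        refine ENNReal.tsum_le_tsum fun m => ?_
        gcongr
        exact gradeNorm_mul φ deg hdeg hφ m a b
    _ = ∑' x : M × M, (gradeNorm φ x.1 a * (ρ : ℝ≥0∞) ^ deg x.1) *
          (gradeNorm φ x.2 b * (ρ : ℝ≥0∞) ^ deg x.2) := by
        simp only [← ENNReal.tsum_mul_right]
        rw [ENNReal.tsum_comm]
        refine tsum_congr fun x => ?_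
        rw [tsum_eq_single (x.1 + x.2)]
        · rw [if_pos rfl, hadd, pow_add]; ring
        · intro m hm
          rw [if_neg (Ne.symm hm), zero_mul]
    _ = _ := by
        rw [← ENNReal.tsum_mul_right]
        simp only [← ENNReal.tsum_mul_left]
        rw [← ENNReal.tsum_prod]

end grade

/-! ### Radius of convergence -/

/-- The radius of convergence of a free series, `1 / R(a) = limsup_d (∑_{|α| = d} |c_α|²)^{1/(2d)}`. -/
def radius (a : FreeSeries n) : ℝ≥0∞ :=
  (Filter.limsup (fun d : ℕ =>
    (∑ α : List.Vector (Fin n) d, ‖a α.toList‖ₑ ^ 2) ^ (1 / (2 * d) : ℝ)) Filter.atTop)⁻¹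

theorem gradeNorm_length (d : ℕ) (a : FreeSeries n) : gradeNorm List.length d a =
    (∑ α : List.Vector (Fin n) d, ‖a α.toList‖ₑ ^ 2) ^ (1 / 2 : ℝ) := by
  have h := tsum_fintype (L := .unconditional _)
    (fun α : List.Vector (Fin n) d => ‖a α.toList‖ₑ ^ 2)
  rw [← h]
  rfl

theorem gradeNorm_length_ne_top (d : ℕ) (a : FreeSeries n) :
    gradeNorm List.length d a ≠ ∞ :=
  ENNReal.rpow_ne_top_of_nonneg (by norm_num)
    (gradeSq_ne_top List.length id (fun _ => rfl) _ _)

theorem rpow_root {x : ℝ≥0∞} {d : ℕ} (hd : d ≠ 0) :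
    (x ^ (1 / (2 * d) : ℝ)) ^ d = x ^ (1 / 2 : ℝ) := by
  rw [← ENNReal.rpow_natCast, ← ENNReal.rpow_mul]
  congr 1
  field_simp

theorem le_radius_iff (r : ℝ≥0∞) (a : FreeSeries n) : r ≤ radius a ↔
    ∀ ρ : ℝ≥0, 0 < ρ → (ρ : ℝ≥0∞) < r → gradeSum List.length id ρ a < ∞ := by
  constructor
  · intro h ρ h0 hρ
    obtain ⟨σ, hσ1, hσ2⟩ := ENNReal.lt_iff_exists_nnreal_btwn.1 hρ
    have hσ1' : ρ < σ := by exact_mod_cast hσ1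
    have hσ0 : 0 < σ := h0.trans hσ1'
    have hlt : (σ : ℝ≥0∞) < radius a := hσ2.trans_le h
    unfold radius at hlt
    rw [ENNReal.lt_inv_iff_lt_inv] at hlt
    have hev := Filter.eventually_lt_of_limsup_lt hlt
    obtain ⟨N, hN⟩ := Filter.eventually_atTop.1 hev
    set f : ℕ → ℝ≥0∞ := fun d => gradeNorm List.length d a * (ρ : ℝ≥0∞) ^ d with hf
    change ∑' d, f d < ∞
    have hfin : ∀ d, f d ≠ ∞ := fun d => ENNReal.mul_ne_top (gradeNorm_length_ne_top d a)
      (ENNReal.pow_ne_top ENNReal.coe_ne_top)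
    rw [← Summable.sum_add_tsum_nat_add' (f := f) (k := N + 1) ENNReal.summable]
    refine ENNReal.add_lt_top.2 ⟨ENNReal.sum_lt_top.2 fun d _ => (hfin d).lt_top, ?_⟩
    have hb : ∀ d, f (d + (N + 1)) ≤ ((ρ / σ : ℝ≥0) : ℝ≥0∞) ^ d := by
      intro d
      have h1 := (hN (d + (N + 1)) (by omega)).le
      have h2 : gradeNorm List.length (d + (N + 1)) a ≤ ((σ : ℝ≥0∞)⁻¹) ^ (d + (N + 1)) := by
        rw [gradeNorm_length, ← rpow_root (d := d + (N + 1)) (by omega)]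
        gcongr
      have h3 : f (d + (N + 1)) ≤ ((ρ / σ : ℝ≥0) : ℝ≥0∞) ^ (d + (N + 1)) := by
        rw [ENNReal.coe_div hσ0.ne', ENNReal.div_eq_inv_mul, mul_pow]
        simp only [hf]
        gcongr
      refine h3.trans ?_
      refine pow_le_pow_of_le_one zero_le ?_ (by omega)
      exact_mod_cast (div_le_one₀ hσ0).2 hσ1'.le
    refine (ENNReal.tsum_le_tsum hb).trans_lt ?_
    rw [ENNReal.tsum_geometric, ENNReal.inv_lt_top, tsub_pos_iff_lt]
    exact_mod_cast (div_lt_one hσ0).2 hσ1'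
  · intro h
    refine ENNReal.le_of_forall_nnreal_lt fun ρ hρ => ?_
    rcases eq_or_ne ρ 0 with rfl | h0
    · simp
    have hs := h ρ (pos_iff_ne_zero.2 h0) hρ
    unfold radius
    rw [ENNReal.le_inv_iff_le_inv]
    have ht : Filter.Tendsto (fun d => gradeNorm List.length d a * (ρ : ℝ≥0∞) ^ d)
        Filter.atTop (𝓝 0) := ENNReal.tendsto_atTop_zero_of_tsum_ne_top hs.ne
    refine Filter.limsup_le_of_le (by isBoundedDefault) ?_
    filter_upwards [ht.eventually_lt_const one_pos, Filter.eventually_ge_atTop 1] with d hd h1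
    have hd0 : d ≠ 0 := by omega
    rw [gradeNorm_length, ← rpow_root hd0, ← mul_pow] at hd
    have := (pow_lt_one_iff hd0).1 hd
    rw [← one_div, ENNReal.le_div_iff_mul_le (Or.inl (by exact_mod_cast h0))
      (Or.inl ENNReal.coe_ne_top)]
    exact this.le

/-! ### Popescu's algebra -/

/-- Popescu's algebra of holomorphic functions on the free `n`-ball of radius `r`: the free series
with radius of convergence at least `r`. -/
def freeBallAlgebra (n : ℕ) (r : ℝ≥0∞) : Subalgebra ℂ (FreeSeries n) where
  carrier := {a | r ≤ radius a}
  add_mem' := by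
    intro a b ha hb
    simp only [Set.mem_ofPred_eq, le_radius_iff] at ha hb ⊢
    exact fun ρ h0 h => (gradeSum_add _ _ ρ a b).trans_lt
      (ENNReal.add_lt_top.2 ⟨ha ρ h0 h, hb ρ h0 h⟩)
  mul_mem' := by
    intro a b ha hb
    simp only [Set.mem_ofPred_eq, le_radius_iff] at ha hb ⊢
    exact fun ρ h0 h => (gradeSum_mul List.length id (fun _ => rfl) (fun _ _ => List.length_append)
      (fun _ _ => rfl) ρ a b).trans_lt (ENNReal.mul_lt_top (ha ρ h0 h) (hb ρ h0 h))
  algebraMap_mem' := by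
    intro z
    simp only [Set.mem_ofPred_eq, le_radius_iff]
    intro ρ h0 h
    rw [Algebra.algebraMap_eq_smul_one, gradeSum_smul]
    exact ENNReal.mul_lt_top enorm_lt_top (gradeSum_one List.length id (fun _ => rfl) ρ).lt_top

/-! ### The algebra of series with finite `ℓ¹(ℓ²)`-norms -/

/-- The map `p : W_n → ℤ₊ⁿ`; the `j`-th coordinate counts the occurrences of `j` in the word. -/
def multidegree (α : List (Fin n)) : Fin n → ℕ := fun j => α.count j

/-- `‖a‖_ρ = ∑_k (∑_{p(α) = k} |c_α|²)^{1/2} ρ^{|k|}`, with values in `[0, ∞]`. -/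
def ballNorm (ρ : ℝ≥0) (a : FreeSeries n) : ℝ≥0∞ :=
  ∑' k : Fin n → ℕ,
    (∑' α : {α : List (Fin n) // multidegree α = k}, ‖a α.1‖ₑ ^ 2) ^ (1 / 2 : ℝ) *
      (ρ : ℝ≥0∞) ^ (∑ j, k j)

theorem ballNorm_eq (ρ : ℝ≥0) (a : FreeSeries n) :
    ballNorm ρ a = gradeSum multidegree (fun k => ∑ j, k j) ρ a := rfl

theorem sum_multidegree (α : List (Fin n)) : ∑ j, multidegree α j = α.length := by
  induction α with
  | nil => simp [multidegree]
  | cons i α ih =>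
    simp only [multidegree, List.count_cons, Finset.sum_add_distrib, List.length_cons] at ih ⊢
    rw [ih]; simp

theorem ballNorm_mul_le (ρ : ℝ≥0) (a b : FreeSeries n) :
    ballNorm ρ (a * b) ≤ ballNorm ρ a * ballNorm ρ b := by
  simp only [ballNorm_eq]
  exact gradeSum_mul _ _ sum_multidegree (fun α β => by ext j; simp [multidegree])
    (fun i j => Finset.sum_add_distrib) ρ a b

/-- The algebra of free series `a` with `‖a‖_ρ < ∞` for all `ρ ∈ (0, r)`. -/
def freeBallSeries (n : ℕ) (r : ℝ≥0∞) : Subalgebra ℂ (FreeSeries n) where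
  carrier := {a | ∀ ρ : ℝ≥0, 0 < ρ → (ρ : ℝ≥0∞) < r → ballNorm ρ a < ∞}
  add_mem' := fun {a b} ha hb ρ h0 h => (gradeSum_add _ _ ρ a b).trans_lt
      (ENNReal.add_lt_top.2 ⟨ha ρ h0 h, hb ρ h0 h⟩)
  mul_mem' := fun {a b} ha hb ρ h0 h => (ballNorm_mul_le ρ a b).trans_lt
      (ENNReal.mul_lt_top (ha ρ h0 h) (hb ρ h0 h))
  algebraMap_mem' := by
    intro z ρ h0 h
    rw [Algebra.algebraMap_eq_smul_one, ballNorm_eq, gradeSum_smul]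
    exact ENNReal.mul_lt_top enorm_lt_top (gradeSum_one _ _ sum_multidegree ρ).lt_top

/-- The norm `‖·‖_ρ` on the algebra `freeBallSeries n r`, for `ρ ∈ (0, r)`. -/
def seriesNorm (n : ℕ) (r : ℝ≥0∞) (ρ : {ρ : ℝ≥0 // 0 < ρ ∧ (ρ : ℝ≥0∞) < r}) :
    Seminorm ℂ (freeBallSeries n r) :=
  Seminorm.of (fun a => (ballNorm ρ.1 (a : FreeSeries n)).toReal)
    (fun a b => by
      have ha := a.2 ρ.1 ρ.2.1 ρ.2.2
      have hb := b.2 ρ.1 ρ.2.1 ρ.2.2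
      rw [← ENNReal.toReal_add ha.ne hb.ne]
      exact ENNReal.toReal_mono (ENNReal.add_ne_top.2 ⟨ha.ne, hb.ne⟩)
        (gradeSum_add multidegree (fun k => ∑ j, k j) ρ.1 _ _))
    (fun z a => by
      have h : ballNorm ρ.1 ((z • a : freeBallSeries n r) : FreeSeries n)
          = ‖z‖ₑ * ballNorm ρ.1 (a : FreeSeries n) := by
        rw [Subalgebra.coe_smul, ballNorm_eq, ballNorm_eq, gradeSum_smul]
      rw [h, ENNReal.toReal_mul, toReal_enorm])

/-- The locally convex topology determined by a family of seminorms. -/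
abbrev familyTopology {E ι : Type} [AddCommGroup E] [Module ℂ E] (p : ι → Seminorm ℂ E) :
    TopologicalSpace E :=
  ⨅ i, (p i).toSeminormedAddCommGroup.toUniformSpace.toTopologicalSpace

/-! ### Evaluation at row tuples of operators -/

section operators
variable {H : Type*} [NormedAddCommGroup H] [InnerProductSpace ℂ H]

/-- The row operator `Hⁿ → H`, `(x₁, …, xₙ) ↦ ∑ Tᵢ xᵢ`, on the Hilbert direct sum. -/
def rowOperator (T : Fin n → H →L[ℂ] H) : PiLp 2 (fun _ : Fin n => H) →L[ℂ] H :=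
  ∑ i, T i ∘L PiLp.proj 2 (fun _ : Fin n => H) i

/-- The homogeneous part `∑_{|α| = d} c_α T_α`. -/
def homogeneousEval (a : FreeSeries n) (T : Fin n → H →L[ℂ] H) (d : ℕ) : H →L[ℂ] H :=
  ∑ α : List.Vector (Fin n) d, a α.toList • (α.toList.map T).prod

/-- `a(T) = ∑_d (∑_{|α| = d} c_α T_α)`. -/
def evalAt (a : FreeSeries n) (T : Fin n → H →L[ℂ] H) : H →L[ℂ] H :=
  ∑' d : ℕ, homogeneousEval a T d

theorem row_bound (T : Fin n → H →L[ℂ] H) (x : Fin n → H) :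
    ‖∑ i, T i (x i)‖ ^ 2 ≤ ‖rowOperator T‖ ^ 2 * ∑ i, ‖x i‖ ^ 2 := by
  have h := (rowOperator T).le_opNorm (WithLp.toLp 2 x)
  have h1 : rowOperator T (WithLp.toLp 2 x) = ∑ i, T i (x i) := by
    simp [rowOperator]
  rw [h1] at h
  have h2 := pow_le_pow_left₀ (norm_nonneg _) h 2
  rw [mul_pow, PiLp.norm_sq_eq_of_L2] at h2
  exact h2

/-- Words of length `d + 1` as a letter followed by a word of length `d`. -/
def consEquiv (d : ℕ) : Fin n × List.Vector (Fin n) d ≃ List.Vector (Fin n) (d + 1) where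
  toFun x := x.1 ::ᵥ x.2
  invFun v := (v.head, v.tail)
  left_inv x := by simp
  right_inv v := by simp

theorem words_bound (T : Fin n → H →L[ℂ] H) (d : ℕ) (x : List.Vector (Fin n) d → H) :
    ‖∑ α : List.Vector (Fin n) d, (α.toList.map T).prod (x α)‖ ^ 2 ≤
      (‖rowOperator T‖ ^ 2) ^ d * ∑ α, ‖x α‖ ^ 2 := by
  induction d with
  | zero =>
    have h (f : List.Vector (Fin n) 0 → ℝ) : ∑ α, f α = f List.Vector.nil :=
      Fintype.sum_eq_single _ fun α hα => (hα (Subsingleton.elim _ _)).elim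
    have h' (f : List.Vector (Fin n) 0 → H) : ∑ α, f α = f List.Vector.nil :=
      Fintype.sum_eq_single _ fun α hα => (hα (Subsingleton.elim _ _)).elim
    rw [h, h']
    simp
  | succ d ih =>
    rw [← (consEquiv d).sum_comp, ← (consEquiv d).sum_comp, Fintype.sum_prod_type,
      Fintype.sum_prod_type]
    have h : ∀ i (β : List.Vector (Fin n) d),
        ((consEquiv d (i, β)).toList.map T).prod (x (consEquiv d (i, β))) =
          T i ((β.toList.map T).prod (x (consEquiv d (i, β)))) := by
      intro i β
      have : (consEquiv d (i, β)).toList = i :: β.toList := List.Vector.toList_cons _ _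
      rw [this]; simp
    simp only [h, ← map_sum]
    refine (row_bound T _).trans ?_
    rw [pow_succ' (‖rowOperator T‖ ^ 2) d, mul_assoc, Finset.mul_sum _ _ ((‖rowOperator T‖ ^ 2) ^ d)]
    gcongr with i _
    exact ih _

theorem homogeneousEval_bound (a : FreeSeries n) (T : Fin n → H →L[ℂ] H) (d : ℕ) :
    ‖homogeneousEval a T d‖ₑ ≤ gradeNorm List.length d a * ‖rowOperator T‖ₑ ^ d := by
  have key : ‖homogeneousEval a T d‖ ≤
      √(∑ α : List.Vector (Fin n) d, ‖a α.toList‖ ^ 2) * ‖rowOperator T‖ ^ d := by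
    refine ContinuousLinearMap.opNorm_le_bound _ (by positivity) fun x => ?_
    have h := words_bound T d (fun α => a α.toList • x)
    have h1 : homogeneousEval a T d x = ∑ α : List.Vector (Fin n) d, (α.toList.map T).prod (a α.toList • x) := by
      simp [homogeneousEval]
    rw [h1]
    refine le_of_sq_le_sq ?_ (by positivity)
    refine h.trans (le_of_eq ?_)
    simp only [norm_smul, mul_pow, ← Finset.sum_mul]
    rw [Real.sq_sqrt (by positivity)]
    ring
  rw [gradeNorm_length]
  have h2 : (∑ α : List.Vector (Fin n) d, ‖a α.toList‖ₑ ^ 2) ^ (1 / 2 : ℝ) =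
      ENNReal.ofReal √(∑ α : List.Vector (Fin n) d, ‖a α.toList‖ ^ 2) := by
    rw [Real.sqrt_eq_rpow, ← ENNReal.ofReal_rpow_of_nonneg (by positivity) (by norm_num),
      ENNReal.ofReal_sum_of_nonneg (fun _ _ => by positivity)]
    simp only [ENNReal.ofReal_pow (norm_nonneg _), ofReal_norm]
  rw [h2, ← ofReal_norm, ← ofReal_norm (rowOperator T), ← ENNReal.ofReal_pow (norm_nonneg _),
    ← ENNReal.ofReal_mul (by positivity)]
  exact ENNReal.ofReal_le_ofReal key

theorem tsum_homogeneousEval_le (a : FreeSeries n) (T : Fin n → H →L[ℂ] H) (ρ : ℝ≥0)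
    (hT : ‖rowOperator T‖ ≤ ρ) :
    ∑' d, ‖homogeneousEval a T d‖ₑ ≤ gradeSum List.length id ρ a := by
  refine ENNReal.tsum_le_tsum fun d => (homogeneousEval_bound a T d).trans ?_
  have : ‖rowOperator T‖ₑ ≤ ρ := by
    rw [enorm_le_coe]; exact hT
  dsimp only [id]
  gcongr

theorem gradeSum_ne_top {r : ℝ≥0∞} (a : freeBallAlgebra n r)
    (ρ : {ρ : ℝ≥0 // 0 < ρ ∧ (ρ : ℝ≥0∞) < r}) :
    gradeSum List.length id ρ.1 (a : FreeSeries n) ≠ ∞ :=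
  ((le_radius_iff r _).1 a.2 ρ.1 ρ.2.1 ρ.2.2).ne

theorem summable_norm_homogeneousEval {r : ℝ≥0∞} (a : freeBallAlgebra n r)
    (ρ : {ρ : ℝ≥0 // 0 < ρ ∧ (ρ : ℝ≥0∞) < r}) (T : Fin n → H →L[ℂ] H)
    (hT : ‖rowOperator T‖ ≤ ρ.1) : Summable fun d => ‖homogeneousEval (a : FreeSeries n) T d‖ := by
  have h := ne_top_of_le_ne_top (gradeSum_ne_top a ρ) (tsum_homogeneousEval_le _ T ρ.1 hT)
  exact (tsum_enorm_ne_top_iff_summable_norm).1 h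

theorem norm_evalAt_le {r : ℝ≥0∞} (a : freeBallAlgebra n r)
    (ρ : {ρ : ℝ≥0 // 0 < ρ ∧ (ρ : ℝ≥0∞) < r}) (T : Fin n → H →L[ℂ] H)
    (hT : ‖rowOperator T‖ ≤ ρ.1) :
    ‖evalAt (a : FreeSeries n) T‖ ≤ (gradeSum List.length id ρ.1 (a : FreeSeries n)).toReal := by
  have h1 : ‖evalAt (a : FreeSeries n) T‖ₑ ≤ gradeSum List.length id ρ.1 (a : FreeSeries n) :=
    (enorm_tsum_le_tsum_enorm (f := homogeneousEval (a : FreeSeries n) T)).trans (tsum_homogeneousEval_le _ T ρ.1 hT)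
  rw [← toReal_enorm]
  exact ENNReal.toReal_mono (gradeSum_ne_top a ρ) h1

theorem bddAbove_evalAt {r : ℝ≥0∞} (a : freeBallAlgebra n r)
    (ρ : {ρ : ℝ≥0 // 0 < ρ ∧ (ρ : ℝ≥0∞) < r}) :
    BddAbove (Set.range fun T : {T : Fin n → H →L[ℂ] H // ‖rowOperator T‖ ≤ ρ.1} =>
      ‖evalAt (a : FreeSeries n) T.1‖) :=
  ⟨_, Set.forall_mem_range.2 fun T => norm_evalAt_le a ρ T.1 T.2⟩

instance (ρ : ℝ≥0) : Nonempty {T : Fin n → H →L[ℂ] H // ‖rowOperator T‖ ≤ ρ} :=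
  ⟨⟨0, by
    have h : rowOperator (0 : Fin n → H →L[ℂ] H) = 0 := by
      ext x
      simp [rowOperator]
    rw [h]
    exact ContinuousLinearMap.opNorm_zero.trans_le ρ.2⟩⟩

theorem homogeneousEval_add (a b : FreeSeries n) (T : Fin n → H →L[ℂ] H) (d : ℕ) :
    homogeneousEval (a + b) T d = homogeneousEval a T d + homogeneousEval b T d := by
  simp only [homogeneousEval, add_apply, add_smul, Finset.sum_add_distrib]

theorem homogeneousEval_smul (z : ℂ) (a : FreeSeries n) (T : Fin n → H →L[ℂ] H) (d : ℕ) :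
    homogeneousEval (z • a) T d = z • homogeneousEval a T d := by
  simp only [homogeneousEval, smul_apply, mul_smul, Finset.smul_sum]

variable (H) [CompleteSpace H]

/-- Popescu's seminorm `‖a‖_ρ^P = sup {‖a(T)‖ : T ∈ B(H)ⁿ, ‖T‖ ≤ ρ}`, for `ρ ∈ (0, r)`. -/
def popescuNorm (n : ℕ) (r : ℝ≥0∞) (ρ : {ρ : ℝ≥0 // 0 < ρ ∧ (ρ : ℝ≥0∞) < r}) :
    Seminorm ℂ (freeBallAlgebra n r) :=
  Seminorm.of (fun a => ⨆ T : {T : Fin n → H →L[ℂ] H // ‖rowOperator T‖ ≤ ρ.1},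
      ‖evalAt (a : FreeSeries n) T.1‖)
    (fun a b => ciSup_le fun T => by
      have ha := (summable_norm_homogeneousEval a ρ T.1 T.2).of_norm
      have hb := (summable_norm_homogeneousEval b ρ T.1 T.2).of_norm
      have h : evalAt ((a + b : freeBallAlgebra n r) : FreeSeries n) T.1 =
          evalAt (a : FreeSeries n) T.1 + evalAt (b : FreeSeries n) T.1 := by
        simp only [evalAt, Subalgebra.coe_add, homogeneousEval_add]
        exact ha.tsum_add hb
      rw [h]
      exact (norm_add_le _ _).trans
        (add_le_add (le_ciSup (bddAbove_evalAt a ρ) T) (le_ciSup (bddAbove_evalAt b ρ) T)))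
    (fun z a => by
      rw [Real.mul_iSup_of_nonneg (norm_nonneg z)]
      refine iSup_congr fun T => ?_
      rw [← norm_smul]
      congr 1
      simp only [evalAt, Subalgebra.coe_smul, homogeneousEval_smul]
      exact tsum_const_smul'' z)

/-- The topology on Popescu's algebra given by the norms `‖·‖_ρ^P`, `ρ ∈ (0, r)`. -/
abbrev popescuTopology (n : ℕ) (r : ℝ≥0∞) : TopologicalSpace (freeBallAlgebra n r) :=
  familyTopology (popescuNorm H n r)

end operators

/-- The topology on `freeBallSeries n r` given by the norms `‖·‖_ρ`, `ρ ∈ (0, r)`. -/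
abbrev seriesTopology (n : ℕ) (r : ℝ≥0∞) : TopologicalSpace (freeBallSeries n r) :=
  familyTopology (seriesNorm n r)

end FreeSeries

end

/-!
Write `N_d(a) = (∑_{|α| = d} |c_α|²)^{1/2}`. All the (semi)norms involved are compared with the
sequence `N_d(a) ρ^d`.

On the one hand, `N_d(a)` is the `ℓ²`-norm of the family of numbers
`(∑_{p(α) = k} |c_α|²)^{1/2}`, `|k| = d`, whose `ℓ¹`-norm enters `‖a‖_ρ`. The `ℓ²`-norm is at most
the `ℓ¹`-norm (`gradeSum_length_le_ballNorm`), and conversely, since there are only polynomially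
many `k` with `|k| = d`, the Cauchy–Schwarz inequality bounds `‖a‖_ρ` by a constant times
`sup_d N_d(a) σ^d` for every `σ > ρ` (`ballNorm_le_of_gradeNorm_le`). Together with the description
of the radius of convergence by the sums `∑_d N_d(a) ρ^d` this gives the equality of the two
algebras (`freeBallAlgebra_eq_freeBallSeries`).

On the other hand, `‖a‖_ρ^P ≤ ∑_d N_d(a) ρ^d ≤ ‖a‖_ρ`. The reverse estimate
`N_d(a) σ^d ≤ ‖a‖_σ^P` (`gradeNorm_mul_pow_le_popescuNorm`) comes from evaluating `a` at `σ` times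
the left creation operators of the full Fock space, truncated to words of length at most `d`; these
act on `H` because an infinite-dimensional Hilbert space contains an orthonormal family indexed by
all words. Applied to the vacuum vector, the component in degree `d` of `a(T)` is
`σ^d ∑_{|α| = d} c_α e_α`.
-/

open scoped NNReal ENNReal Topology

namespace FreeSeries
variable {n : ℕ}

/-! ### Comparison of the two gradings -/

theorem tsum_sq_le_sq_tsum {ι : Type} (f : ι → ℝ≥0∞) : ∑' i, f i ^ 2 ≤ (∑' i, f i) ^ 2 := by
  rw [sq (∑' i, f i), ← ENNReal.tsum_mul_right]
  refine ENNReal.tsum_le_tsum fun i => ?_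
  rw [sq]
  gcongr
  exact ENNReal.le_tsum i

theorem gradeNorm_sq {M : Type} (φ : List (Fin n) → M) (m : M) (a : FreeSeries n) :
    gradeNorm φ m a ^ 2 = ∑' α : {α : List (Fin n) // φ α = m}, ‖a α.1‖ₑ ^ 2 := by
  rw [gradeNorm, ← ENNReal.rpow_two, ← ENNReal.rpow_mul]
  norm_num

theorem gradeNorm_length_eq (d : ℕ) (a : FreeSeries n) :
    gradeNorm List.length d a =
      (∑' k : {k : Fin n → ℕ // ∑ j, k j = d}, gradeNorm multidegree k.1 a ^ 2) ^ (1 / 2 : ℝ) := by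
  simp only [gradeNorm_sq]
  rw [gradeNorm, ← (Equiv.sigmaSubtypeFiberEquivSubtype (multidegree (n := n))
    (p := fun α => α.length = d) (q := fun k => ∑ j, k j = d)
    (fun α => by rw [sum_multidegree])).tsum_eq, ENNReal.tsum_sigma']
  rfl

theorem ballNorm_eq_tsum_degree (ρ : ℝ≥0) (a : FreeSeries n) :
    ballNorm ρ a = ∑' d : ℕ, (∑' k : {k : Fin n → ℕ // ∑ j, k j = d},
      gradeNorm multidegree k.1 a) * (ρ : ℝ≥0∞) ^ d := by
  rw [ballNorm_eq, gradeSum, ← (Equiv.sigmaFiberEquiv (fun k : Fin n → ℕ => ∑ j, k j)).tsum_eq,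
    ENNReal.tsum_sigma']
  refine tsum_congr fun d => ?_
  rw [← ENNReal.tsum_mul_right]
  refine tsum_congr fun k => ?_
  simp [Equiv.sigmaFiberEquiv, k.2]

/-- The `ℓ²`-norm of the homogeneous parts in multidegrees `k` with `|k| = d` is at most their
`ℓ¹`-norm. -/
theorem gradeSum_length_le_ballNorm (ρ : ℝ≥0) (a : FreeSeries n) :
    gradeSum List.length id ρ a ≤ ballNorm ρ a := by
  rw [ballNorm_eq_tsum_degree, gradeSum]
  refine ENNReal.tsum_le_tsum fun d => ?_
  dsimp only [id]
  gcongr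
  rw [gradeNorm_length_eq, one_div, ENNReal.rpow_inv_le_iff (by norm_num), ENNReal.rpow_two]
  exact tsum_sq_le_sq_tsum _

theorem tsum_one_multidegree_le (n d : ℕ) :
    ∑' _ : {k : Fin n → ℕ // ∑ j, k j = d}, (1 : ℝ≥0∞) ≤ ((d : ℝ≥0∞) + 1) ^ n := by
  let e : {k : Fin n → ℕ // ∑ j, k j = d} → (Fin n → Fin (d + 1)) := fun k j =>
    ⟨k.1 j, Nat.lt_succ_of_le
      ((Finset.single_le_sum (fun _ _ => Nat.zero_le _) (Finset.mem_univ j)).trans k.2.le)⟩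
  have he : Function.Injective e := fun k l h => by
    ext j
    exact congrArg Fin.val (congrFun h j)
  refine (ENNReal.tsum_comp_le_tsum_of_injective he (fun _ => 1)).trans (le_of_eq ?_)
  simp

theorem tsum_gradeNorm_multidegree_le (d : ℕ) (a : FreeSeries n) :
    ∑' k : {k : Fin n → ℕ // ∑ j, k j = d}, gradeNorm multidegree k.1 a ≤
      ((d : ℝ≥0∞) + 1) ^ n * gradeNorm List.length d a := by
  have h := tsum_cauchySchwarz (fun _ : {k : Fin n → ℕ // ∑ j, k j = d} => 1)
    (fun k => gradeNorm multidegree k.1 a)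
  simp only [one_mul, one_pow, ← gradeNorm_length_eq] at h
  refine h.trans ?_
  gcongr
  refine (ENNReal.rpow_le_rpow (tsum_one_multidegree_le n d) (by norm_num)).trans ?_
  refine (ENNReal.rpow_le_rpow_of_exponent_le (one_le_pow₀ le_add_self) ?_).trans_eq
    (ENNReal.rpow_one _)
  norm_num

theorem tsum_succ_pow_mul_geometric_ne_top (n : ℕ) {q : ℝ≥0} (hq : q < 1) :
    ∑' d : ℕ, ((d : ℝ≥0∞) + 1) ^ n * (q : ℝ≥0∞) ^ d ≠ ∞ := by
  have h : Summable fun d : ℕ => ((d : ℝ≥0) + 1) ^ n * q ^ d := by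
    rcases eq_or_ne q 0 with rfl | h0
    · refine summable_of_ne_finset_zero (s := {0}) fun d hd => ?_
      simp at hd
      simp [hd]
    rw [← NNReal.summable_coe]
    -- the series is `q⁻¹ * ∑ d ^ n * q ^ d` without its term at `d = 0`
    have h1 := (summable_nat_add_iff 1).2 (summable_pow_mul_geometric_of_norm_lt_one (R := ℝ) n
      (r := q) (by simpa using hq))
    have h2 := h1.mul_right ((q : ℝ)⁻¹)
    refine h2.congr fun d => ?_
    have : (q : ℝ) ≠ 0 := by exact_mod_cast h0
    push_cast
    field_simp
    ring
  have h3 := ENNReal.tsum_coe_ne_top_iff_summable.2 h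
  push_cast at h3
  exact h3

/-- A Cauchy estimate: there are at most `(d + 1)^n` multidegrees `k` with `|k| = d`, and this
polynomial growth is absorbed by the geometric factor `(ρ / σ)^d`; the bound has content for
`ρ < σ`. -/
theorem ballNorm_le_of_gradeNorm_le {ρ σ : ℝ≥0} (hσ : 0 < σ) (a : FreeSeries n) {P : ℝ≥0∞}
    (h : ∀ d, gradeNorm List.length d a * (σ : ℝ≥0∞) ^ d ≤ P) :
    ballNorm ρ a ≤ (∑' d : ℕ, ((d : ℝ≥0∞) + 1) ^ n * ((ρ / σ : ℝ≥0) : ℝ≥0∞) ^ d) * P := by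
  rw [ballNorm_eq_tsum_degree, ← ENNReal.tsum_mul_right]
  refine ENNReal.tsum_le_tsum fun d => ?_
  have hρ : (ρ : ℝ≥0∞) ^ d = ((ρ / σ : ℝ≥0) : ℝ≥0∞) ^ d * (σ : ℝ≥0∞) ^ d := by
    rw [← mul_pow, ← ENNReal.coe_mul, div_mul_cancel₀ _ hσ.ne']
  calc _ ≤ (((d : ℝ≥0∞) + 1) ^ n * gradeNorm List.length d a) * (ρ : ℝ≥0∞) ^ d := by
        gcongr
        exact tsum_gradeNorm_multidegree_le d a
    _ = ((d : ℝ≥0∞) + 1) ^ n * ((ρ / σ : ℝ≥0) : ℝ≥0∞) ^ d *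
          (gradeNorm List.length d a * (σ : ℝ≥0∞) ^ d) := by rw [hρ]; ring
    _ ≤ _ := by gcongr; exact h d

theorem freeBallAlgebra_eq_freeBallSeries (n : ℕ) (r : ℝ≥0∞) :
    freeBallAlgebra n r = freeBallSeries n r := by
  ext a
  change r ≤ radius a ↔ ∀ ρ : ℝ≥0, 0 < ρ → (ρ : ℝ≥0∞) < r → ballNorm ρ a < ∞
  rw [le_radius_iff]
  refine ⟨fun h ρ h0 hρ => ?_, fun h ρ h0 hρ =>
    (gradeSum_length_le_ballNorm ρ a).trans_lt (h ρ h0 hρ)⟩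
  obtain ⟨σ, hρσ, hσ⟩ := ENNReal.lt_iff_exists_nnreal_btwn.1 hρ
  have hρσ' : ρ < σ := by exact_mod_cast hρσ
  have hσ0 := h0.trans hρσ'
  refine (ballNorm_le_of_gradeNorm_le (ρ := ρ) hσ0 a fun d =>
    ENNReal.le_tsum (f := fun d => gradeNorm List.length d a * (σ : ℝ≥0∞) ^ d) d).trans_lt ?_
  exact ENNReal.mul_lt_top
    (tsum_succ_pow_mul_geometric_ne_top n ((div_lt_one hσ0).2 hρσ')).lt_top (h σ hσ0 hσ)

theorem eq_zero_of_ballNorm_eq_zero {ρ : ℝ≥0} (hρ : 0 < ρ) {a : FreeSeries n}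
    (h : ballNorm ρ a = 0) : a = 0 := by
  refine ext' fun α => ?_
  have h1 := ENNReal.tsum_eq_zero.1 h (multidegree α)
  have hρ' : (ρ : ℝ≥0∞) ≠ 0 := by exact_mod_cast hρ.ne'
  have h2 := (mul_eq_zero.1 h1).resolve_right (pow_ne_zero _ hρ')
  rw [ENNReal.rpow_eq_zero_iff_of_pos (by norm_num)] at h2
  simpa [zero_apply] using ENNReal.tsum_eq_zero.1 h2 ⟨α, rfl⟩

/-! ### Truncated creation operators -/

section creation
variable {H : Type*} [NormedAddCommGroup H] [InnerProductSpace ℂ H]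

theorem exists_orthonormal_of_not_finiteDimensional [CompleteSpace H]
    (hH : ¬ FiniteDimensional ℂ H) (ι : Type*) [Countable ι] :
    ∃ e : ι → H, Orthonormal ℂ e := by
  obtain ⟨w, b, hb⟩ := exists_hilbertBasis ℂ H
  have hw : Infinite w := by
    by_contra hfin
    have : Finite w := not_infinite_iff_finite.1 hfin
    have := Fintype.ofFinite w
    exact hH b.toOrthonormalBasis.toBasis.finiteDimensional_of_finite
  obtain ⟨f, hf⟩ := exists_injective_nat ι
  exact ⟨_, b.orthonormal.comp _ ((Infinite.natEmbedding w).injective.comp hf)⟩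

/-- Words of length less than `d`. -/
noncomputable def shortWords (n d : ℕ) : Finset (List (Fin n)) :=
  (List.finite_length_lt (Fin n) d).toFinset

/-- The left creation operator `e_w ↦ e_{iw}` for `|w| < d`, scaled by `σ`; it vanishes on the
orthogonal complement of these `e_w`. -/
noncomputable def truncatedCreation (e : List (Fin n) → H) (σ : ℝ≥0) (d : ℕ) (i : Fin n) :
    H →L[ℂ] H :=
  ((σ : ℝ) : ℂ) • ∑ w ∈ shortWords n d, (innerSL ℂ (e w)).smulRight (e (i :: w))

theorem truncatedCreation_apply (e : List (Fin n) → H) (σ : ℝ≥0) (d : ℕ) (i : Fin n) (x : H) :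
    truncatedCreation e σ d i x =
      ((σ : ℝ) : ℂ) • ∑ w ∈ shortWords n d, inner ℂ (e w) x • e (i :: w) := by
  simp [truncatedCreation]

/-- The creation operators have orthogonal ranges, so Bessel's inequality bounds the row
they form. -/
theorem norm_rowOperator_truncatedCreation_le {e : List (Fin n) → H} (he : Orthonormal ℂ e)
    (σ : ℝ≥0) (d : ℕ) : ‖rowOperator (truncatedCreation e σ d)‖ ≤ σ := by
  refine ContinuousLinearMap.opNorm_le_bound _ σ.2 fun x => ?_
  have hrow : rowOperator (truncatedCreation e σ d) x = ((σ : ℝ) : ℂ) •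
      ∑ p ∈ Finset.univ ×ˢ shortWords n d, inner ℂ (e p.2) (x p.1) • e (p.1 :: p.2) := by
    simp [rowOperator, truncatedCreation_apply, Finset.smul_sum, Finset.sum_product]
  have hcons : Orthonormal ℂ fun p : Fin n × List (Fin n) => e (p.1 :: p.2) :=
    he.comp (fun p : Fin n × List (Fin n) => p.1 :: p.2) fun p q h => by
      simp only [List.cons.injEq] at h
      exact Prod.ext h.1 h.2
  rw [hrow, norm_smul, Complex.norm_real, Real.norm_of_nonneg σ.coe_nonneg]
  refine mul_le_mul_of_nonneg_left ?_ σ.2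
  refine le_of_sq_le_sq ?_ (norm_nonneg _)
  have hpyth := hcons.inner_sum (fun p => inner ℂ (e p.2) (x p.1))
    (fun p => inner ℂ (e p.2) (x p.1)) (Finset.univ ×ˢ shortWords n d)
  simp only [inner_self_eq_norm_sq_to_K, RCLike.conj_mul] at hpyth
  rw [show ‖_‖ ^ 2 = _ by exact_mod_cast hpyth, PiLp.norm_sq_eq_of_L2, Finset.sum_product]
  exact Finset.sum_le_sum fun i _ => he.sum_inner_products_le (x i)

theorem truncatedCreation_apply_basis {e : List (Fin n) → H} (he : Orthonormal ℂ e) (σ : ℝ≥0)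
    (d : ℕ) (i : Fin n) (v : List (Fin n)) :
    truncatedCreation e σ d i (e v) =
      if v.length < d then ((σ : ℝ) : ℂ) • e (i :: v) else 0 := by
  classical
  rw [truncatedCreation_apply]
  simp only [orthonormal_iff_ite.1 he, ite_smul, one_smul, zero_smul, Finset.sum_ite_eq']
  have : v ∈ shortWords n d ↔ v.length < d := by simp [shortWords]
  simp only [this]
  split_ifs <;> simp

theorem prod_truncatedCreation_apply_vacuum {e : List (Fin n) → H} (he : Orthonormal ℂ e)
    (σ : ℝ≥0) (d : ℕ) (α : List (Fin n)) :
    (α.map (truncatedCreation e σ d)).prod (e []) =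
      if α.length ≤ d then ((σ : ℝ) : ℂ) ^ α.length • e α else 0 := by
  induction α with
  | nil => simp
  | cons i α ih =>
    rw [List.map_cons, List.prod_cons, mul_apply_eq_comp, ih]
    by_cases h : α.length < d
    · rw [if_pos h.le, map_smul, truncatedCreation_apply_basis he, if_pos h,
        if_pos (by simpa using h), smul_smul, List.length_cons, pow_succ]
    · rw [if_neg (by simpa using h : ¬ (i :: α).length ≤ d)]
      split_ifs
      · rw [map_smul, truncatedCreation_apply_basis he, if_neg h, smul_zero]
      · rw [map_zero]

theorem inner_homogeneousEval_truncatedCreation {e : List (Fin n) → H} (he : Orthonormal ℂ e)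
    (σ : ℝ≥0) (a : FreeSeries n) (α : List (Fin n)) (m : ℕ) :
    inner ℂ (e α) (homogeneousEval a (truncatedCreation e σ α.length) m (e [])) =
      if m = α.length then a α * ((σ : ℝ) : ℂ) ^ α.length else 0 := by
  classical
  simp only [homogeneousEval, _root_.sum_apply, _root_.smul_apply,
    prod_truncatedCreation_apply_vacuum he, inner_sum, List.Vector.toList_length]
  by_cases h : m = α.length
  · subst h
    rw [if_pos rfl, Fintype.sum_eq_single ⟨α, rfl⟩]
    · simp [he.1, inner_smul_right, List.Vector.toList]
    · intro β hβ
      have : α ≠ β.toList := fun h => hβ (Subtype.ext h.symm)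
      simp [inner_smul_right, orthonormal_iff_ite.1 he, this]
  · rw [if_neg h]
    refine Finset.sum_eq_zero fun β _ => ?_
    have : α ≠ β.toList := fun h' => h (by rw [h', List.Vector.toList_length])
    split_ifs <;> simp [inner_smul_right, orthonormal_iff_ite.1 he, this]

variable [CompleteSpace H]

/-- The coefficients in degree `d` are read off from `a(T) e_∅`, where `T` is the row of truncated
creation operators of norm at most `σ`. -/
theorem gradeNorm_mul_pow_le_popescuNorm (hH : ¬ FiniteDimensional ℂ H) {r : ℝ≥0∞}
    (σ : {ρ : ℝ≥0 // 0 < ρ ∧ (ρ : ℝ≥0∞) < r}) (a : freeBallAlgebra n r) (d : ℕ) :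
    gradeNorm List.length d (a : FreeSeries n) * (σ.1 : ℝ≥0∞) ^ d ≤
      ENNReal.ofReal (popescuNorm H n r σ a) := by
  obtain ⟨e, he⟩ := exists_orthonormal_of_not_finiteDimensional hH (List (Fin n))
  set T := truncatedCreation e σ.1 d with hTdef
  have hT : ‖rowOperator T‖ ≤ σ.1 := norm_rowOperator_truncatedCreation_le he σ.1 d
  have hsum := (summable_norm_homogeneousEval a σ T hT).of_norm
  have hle : ‖evalAt (a : FreeSeries n) T‖ ≤ popescuNorm H n r σ a :=
    le_ciSup (bddAbove_evalAt a σ) ⟨T, hT⟩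
  have hinner (α : List.Vector (Fin n) d) :
      inner ℂ (e α.toList) (evalAt (a : FreeSeries n) T (e [])) =
        (a : FreeSeries n) α.toList * ((σ.1 : ℝ) : ℂ) ^ d := by
    have h1 : HasSum (fun m => inner ℂ (e α.toList) (homogeneousEval (a : FreeSeries n) T m (e [])))
        (inner ℂ (e α.toList) (evalAt (a : FreeSeries n) T (e []))) :=
      ((innerSL ℂ (e α.toList)) ∘L (ContinuousLinearMap.apply ℂ H (e []))).hasSum hsum.hasSum
    have h2 (m : ℕ) := inner_homogeneousEval_truncatedCreation he σ.1 (a : FreeSeries n) α.toList m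
    rw [List.Vector.toList_length, ← hTdef] at h2
    simp only [h2] at h1
    exact h1.unique (hasSum_ite_eq d _)
  have hbessel := (he.comp (fun α : List.Vector (Fin n) d => α.toList)
    Subtype.val_injective).sum_inner_products_le (s := Finset.univ)
    (evalAt (a : FreeSeries n) T (e []))
  simp only [Function.comp_apply, hinner, norm_mul, norm_pow, Complex.norm_real, mul_pow,
    ← Finset.sum_mul] at hbessel
  rw [Real.norm_of_nonneg σ.1.coe_nonneg] at hbessel
  have hev : ‖evalAt (a : FreeSeries n) T (e [])‖ ≤ popescuNorm H n r σ a := by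
    refine ((evalAt (a : FreeSeries n) T).le_opNorm _).trans ?_
    rw [he.1, mul_one]
    exact hle
  have hsqrt : √(∑ α : List.Vector (Fin n) d, ‖(a : FreeSeries n) α.toList‖ ^ 2) * (σ.1 : ℝ) ^ d ≤
      popescuNorm H n r σ a := by
    refine le_trans (le_of_sq_le_sq ?_ (norm_nonneg _)) hev
    rw [mul_pow, Real.sq_sqrt (by positivity)]
    exact hbessel
  rw [gradeNorm_length]
  refine le_trans (le_of_eq ?_) (ENNReal.ofReal_le_ofReal hsqrt)
  rw [ENNReal.ofReal_mul (by positivity), ENNReal.ofReal_pow σ.1.coe_nonneg, ENNReal.ofReal_coe_nnreal,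
    Real.sqrt_eq_rpow, ← ENNReal.ofReal_rpow_of_nonneg (by positivity) (by norm_num),
    ENNReal.ofReal_sum_of_nonneg (fun _ _ => by positivity)]
  simp only [ENNReal.ofReal_pow (norm_nonneg _), ofReal_norm]

end creation

/-! ### Comparison of the topologies -/

/-- A linear map is continuous for the topologies given by two families of seminorms as soon as
every seminorm of the target is bounded, up to a constant, by one seminorm of the source. -/
theorem continuous_familyTopology {E F ι κ : Type} [AddCommGroup E] [Module ℂ E]
    [AddCommGroup F] [Module ℂ F] (p : ι → Seminorm ℂ E) (q : κ → Seminorm ℂ F) (f : E →ₗ[ℂ] F)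
    (h : ∀ k, ∃ i, ∃ C : ℝ, ∀ x, q k (f x) ≤ C * p i x) :
    Continuous[familyTopology p, familyTopology q] f := by
  refine continuous_iInf_rng.2 fun k => ?_
  obtain ⟨i, C, hC⟩ := h k
  refine continuous_iInf_dom (i := i) ?_
  let := (p i).toSeminormedAddCommGroup
  let := (q k).toSeminormedAddCommGroup
  exact AddMonoidHomClass.continuous_of_bound f C hC

theorem popescuNorm_le_toReal_ballNorm {H : Type*} [NormedAddCommGroup H]
    [InnerProductSpace ℂ H] [CompleteSpace H] {r : ℝ≥0∞}
    (ρ : {ρ : ℝ≥0 // 0 < ρ ∧ (ρ : ℝ≥0∞) < r}) (a : freeBallAlgebra n r) :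
    popescuNorm H n r ρ a ≤ (ballNorm ρ.1 (a : FreeSeries n)).toReal := by
  have ha : (a : FreeSeries n) ∈ freeBallSeries n r := freeBallAlgebra_eq_freeBallSeries n r ▸ a.2
  exact ciSup_le fun T => (norm_evalAt_le a ρ T.1 T.2).trans
    (ENNReal.toReal_mono (ha ρ.1 ρ.2.1 ρ.2.2).ne (gradeSum_length_le_ballNorm ρ.1 _))

/-- The Popescu norm has to be taken at a larger radius `σ ∈ (ρ, r)`. -/
theorem exists_toReal_ballNorm_le_popescuNorm {H : Type*} [NormedAddCommGroup H]
    [InnerProductSpace ℂ H] [CompleteSpace H] (hH : ¬ FiniteDimensional ℂ H) (n : ℕ) {r : ℝ≥0∞}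
    (ρ : {ρ : ℝ≥0 // 0 < ρ ∧ (ρ : ℝ≥0∞) < r}) :
    ∃ σ : {ρ : ℝ≥0 // 0 < ρ ∧ (ρ : ℝ≥0∞) < r}, ∃ C : ℝ, ∀ a : freeBallAlgebra n r,
      (ballNorm ρ.1 (a : FreeSeries n)).toReal ≤ C * popescuNorm H n r σ a := by
  obtain ⟨σ, hρσ, hσ⟩ := ENNReal.lt_iff_exists_nnreal_btwn.1 ρ.2.2
  have hρσ' : ρ.1 < σ := by exact_mod_cast hρσ
  have hσ0 := ρ.2.1.trans hρσ'
  refine ⟨⟨σ, hσ0, hσ⟩,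
    (∑' d : ℕ, ((d : ℝ≥0∞) + 1) ^ n * ((ρ.1 / σ : ℝ≥0) : ℝ≥0∞) ^ d).toReal, fun a => ?_⟩
  have h := ballNorm_le_of_gradeNorm_le (ρ := ρ.1) hσ0 (a : FreeSeries n)
    (gradeNorm_mul_pow_le_popescuNorm hH ⟨σ, hσ0, hσ⟩ a)
  have hC := tsum_succ_pow_mul_geometric_ne_top n ((div_lt_one hσ0).2 hρσ')
  refine (ENNReal.toReal_mono (ENNReal.mul_ne_top hC ENNReal.ofReal_ne_top) h).trans_eq ?_
  rw [ENNReal.toReal_mul, ENNReal.toReal_ofReal (apply_nonneg _ _)]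

end FreeSeries

theorem mainTheorem6 {H : Type*} [NormedAddCommGroup H] [InnerProductSpace ℂ H] [CompleteSpace H]
    (hH : ¬ FiniteDimensional ℂ H) (n : ℕ) (r : ℝ≥0∞) (hr : 0 < r) :
    (∃ Φ : FreeSeries.freeBallAlgebra n r ≃ₐ[ℂ] FreeSeries.freeBallSeries n r,
      (∀ a, (Φ a : FreeSeries n) = (a : FreeSeries n)) ∧
      Continuous[FreeSeries.popescuTopology H n r, FreeSeries.seriesTopology n r] Φ ∧
      Continuous[FreeSeries.seriesTopology n r, FreeSeries.popescuTopology H n r] Φ.symm) ∧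
    ∀ ρ : {ρ : ℝ≥0 // 0 < ρ ∧ (ρ : ℝ≥0∞) < r},
      (∀ a : FreeSeries.freeBallSeries n r, FreeSeries.seriesNorm n r ρ a = 0 → a = 0) ∧
      ∀ a b : FreeSeries.freeBallSeries n r,
        FreeSeries.seriesNorm n r ρ (a * b) ≤
          FreeSeries.seriesNorm n r ρ a * FreeSeries.seriesNorm n r ρ b := by
  refine ⟨⟨Subalgebra.equivOfEq _ _ (FreeSeries.freeBallAlgebra_eq_freeBallSeries n r),
    fun a => rfl, ?_, ?_⟩, fun ρ => ⟨fun a ha => ?_, fun a b => ?_⟩⟩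
  · exact FreeSeries.continuous_familyTopology _ _ (Subalgebra.equivOfEq _ _
      (FreeSeries.freeBallAlgebra_eq_freeBallSeries n r)).toLinearMap
      fun ρ => FreeSeries.exists_toReal_ballNorm_le_popescuNorm hH n ρ
  · exact FreeSeries.continuous_familyTopology _ _ (Subalgebra.equivOfEq _ _
      (FreeSeries.freeBallAlgebra_eq_freeBallSeries n r)).symm.toLinearMap
      fun ρ => ⟨ρ, 1, fun a => (FreeSeries.popescuNorm_le_toReal_ballNorm ρ _).trans_eq
        (one_mul _).symm⟩
  · refine Subtype.ext (FreeSeries.eq_zero_of_ballNorm_eq_zero ρ.2.1 ?_)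
    exact ((ENNReal.toReal_eq_zero_iff _).1 ha).resolve_right (a.2 ρ.1 ρ.2.1 ρ.2.2).ne
  · refine (ENNReal.toReal_mono ?_ (FreeSeries.ballNorm_mul_le ρ.1 (a : FreeSeries n)
      (b : FreeSeries n))).trans_eq ENNReal.toReal_mul
    exact ENNReal.mul_ne_top (a.2 ρ.1 ρ.2.1 ρ.2.2).ne (b.2 ρ.1 ρ.2.1 ρ.2.2).ne
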